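/- Let $P,Q\in\mathbb C[T]$ be polynomials of degree at least $2$ with $P(0)=Q(0)=0$, let $F:\mathbb C^2\to\mathbb C^2$, $F(z,w)=(P(z),Q(w))$, and suppose that one of the following holds: (1) $P(z)=z^m$ for some $m$, and $0<|Q'(0)|<1$; (2) $P(z)=z^m$ for some $m$, and $Q'(0)=1$; (3) $0<|P'(0)|<1$ and $Q'(0)=1$; (4) $P'(0)=Q'(0)=1$. Let $\Omega$ be an immediate basin of the fixed point $(0,0)$ of $F$, that is, a connected component of the interior of $\{x\in\mathbb C^2: F^n(x)\to(0,0)\}$ such that $F(\Omega)\subseteq\Omega$. (In case (1) it is the component containing $(0,0)$; in the other cases there can be several, according to the attracting directions at the parabolic fixed point $0$ of $Q$, or of $P$ and $Q$.) Then there is an $r>0$ such that for every point $p\in\mathbb C^2$ with $\|p\|<r$ (in particular for $p=(0,0)$) and for every constant $C>0$ there exists a point $(z_0,w_0)\in\Omega$ such that $$d_\Omega\big((z_0,w_0),(\tilde z,\tilde w)\big)\ \ge\ C\qquad\text{for all } (\tilde z,\tilde w)\in\Omega\cap\bigcup_{k\ge0}F^{-k}(p).$$ Here $d_\Omega$ is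 the Kobayashi distance on $\Omega$: $d_\Omega(x,y)$ is the infimum of $\int_0^1 K_\Omega(\gamma(t),\gamma'(t))\,dt$ over the piecewise $C^1$ curves $\gamma:[0,1]\to\Omega$ from $x$ to $y$, where $K_\Omega(x,\xi)=\inf\{\lambda>0:\ \exists f:\{|\zeta|<1\}\to\Omega\text{ holomorphic},\ f(0)=x,\ \lambda f'(0)=\xi\}$. -/

import Mathlib

open Set Filter Topology MeasureTheory
open scoped ENNReal

noncomputable section

/-- The infinitesimal Kobayashi metric of `Ω` at the point `z` in the direction `ξ`: the infimum of
the `r > 0` for which some holomorphic map `f` from the unit disc to `Ω` satisfies `f 0 = z` and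
`r • f' 0 = ξ`. -/
def kobayashiMetric {E : Type*} [NormedAddCommGroup E] [NormedSpace ℂ E]
    (Ω : Set E) (z ξ : E) : ℝ≥0∞ :=
  sInf {l : ℝ≥0∞ | ∃ (r : ℝ) (f : ℂ → E), 0 < r ∧ l = ENNReal.ofReal r ∧
    DifferentiableOn ℂ f (Metric.ball 0 1) ∧ MapsTo f (Metric.ball 0 1) Ω ∧
    f 0 = z ∧ (r : ℂ) • deriv f 0 = ξ}

/-- `γ` is a piecewise `C¹` curve `[0, 1] → Ω` from `x` to `y` (values of `γ` off `[0, 1]` play no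
role). -/
structure IsPiecewiseC1Curve {E : Type*} [NormedAddCommGroup E] [NormedSpace ℂ E]
    (Ω : Set E) (x y : E) (γ : ℝ → E) : Prop where
  mapsTo : MapsTo γ (Icc 0 1) Ω
  source : γ 0 = x
  target : γ 1 = y
  continuousOn : ContinuousOn γ (Icc 0 1)
  piecewise : ∃ (n : ℕ) (t : ℕ → ℝ), Monotone t ∧ t 0 = 0 ∧ t n = 1 ∧
    ∀ i < n, ContDiffOn ℝ 1 γ (Icc (t i) (t (i + 1)))

/-- The Kobayashi length of a curve parametrized by `[0, 1]`. -/
def kobayashiLength {E : Type*} [NormedAddCommGroup E] [NormedSpace ℂ E]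
    (Ω : Set E) (γ : ℝ → E) : ℝ≥0∞ :=
  ∫⁻ t in Icc (0 : ℝ) 1, kobayashiMetric Ω (γ t) (deriv γ t)

/-- The Kobayashi distance of `Ω`: the infimum of the Kobayashi lengths of the piecewise `C¹` curves
in `Ω` joining the two points (`⊤` if there are none). -/
def kobayashiDist {E : Type*} [NormedAddCommGroup E] [NormedSpace ℂ E]
    (Ω : Set E) (x y : E) : ℝ≥0∞ :=
  sInf {l : ℝ≥0∞ | ∃ γ : ℝ → E, IsPiecewiseC1Curve Ω x y γ ∧ l = kobayashiLength Ω γ}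

/-- The set of points whose forward orbit under `f` converges to `p`. -/
def attractionBasin {X : Type*} [TopologicalSpace X] (f : X → X) (p : X) : Set X :=
  {x | Tendsto (fun n : ℕ => f^[n] x) atTop (𝓝 p)}

/-- `Ω` is an immediate basin of the fixed point `p` of `f`: a connected component of the interior
of the set of points attracted to `p` which is mapped into itself by `f`. For an attracting fixed
point the set of attracted points is open and `Ω` is its component containing `p`. For a parabolic
fixed point of multiplier `1` of a polynomial, taking the interior discards the iterated preimages of
`p`, which lie in the Julia set, and there is one such `Ω` for each attracting direction at `p`. -/
def IsImmediateBasin {X : Type*} [TopologicalSpace X] (f : X → X) (p : X) (Ω : Set X) : Prop :=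
  (∃ x ∈ interior (attractionBasin f p),
    Ω = connectedComponentIn (interior (attractionBasin f p)) x) ∧
  MapsTo f Ω Ω

/-- The product map `(z, w) ↦ (P z, Q w)` of `ℂ²`. -/
def productMap (P Q : Polynomial ℂ) (x : ℂ × ℂ) : ℂ × ℂ :=
  (P.eval x.1, Q.eval x.2)

end

/-!
A bounded plane domain `U` lies, for each boundary point `a`, in a punctured disc centred at `a`.
On the punctured disc `log log (R / |z - a|) / 2` is `1`-Lipschitz for the Kobayashi distance, by
the Schwarz lemma applied to a logarithm of `z - a`, so every Kobayashi ball of `U` is relatively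
compact in `U`. The components of the basin are products `U × V` of bounded plane domains, and
`d_{U × V}` dominates `d_U` and `d_V`.

If a coordinate of `p`, say the first, differs from that of the fixed point, then the preimages of
`p` of high order leave every compact subset of `U` in the first coordinate, because the iterates
converge locally uniformly to the fixed point, while those of low order have finitely many second
coordinates: fix any `z` in `U`, and take `w` close to the boundary of `V`. If `p` is the fixed
point, the preimages in the basin have finitely many coordinates in one of the factors: only `0`
for `z ^ m`, and none for a parabolic polynomial, since a nonconstant polynomial, being open,
would bring the fixed point into the interior of its basin, where the derivatives of the iterates
tend to `0`.
-/

section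

open Metric
open scoped NNReal

section SchwarzPunctured

theorem norm_deriv_le_of_re_lt {h : ℂ → ℂ} {c : ℂ} {r M : ℝ} (hr : 0 < r)
    (hd : DifferentiableOn ℂ h (ball c r)) (hM : ∀ z ∈ ball c r, (h z).re < M) :
    ‖deriv h c‖ ≤ 2 * (M - (h c).re) / r := by
  have hshift : MapsTo (fun w ↦ c + w) (ball 0 r) (ball c r) := fun w hw ↦ by
    simpa [dist_eq_norm] using hw
  have hgrowth : ∀ w ∈ ball (0 : ℂ) r,
      ‖h (c + w) - h c‖ ≤ 2 * (M - (h c).re) * ‖w‖ / (r - ‖w‖) := fun w hw ↦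
    Complex.borelCaratheodory_zero (sub_pos.2 (hM c (mem_ball_self hr)))
      ((hd.comp (by fun_prop) hshift).sub_const (h c))
      (fun z hz ↦ by simpa using (hM _ (hshift hz)).le) hr hw (by simp)
  have hslope : ∀ᶠ w : ℂ in 𝓝[≠] 0,
      ‖w⁻¹ • (h (c + w) - h c)‖ ≤ 2 * (M - (h c).re) / (r - ‖w‖) := by
    filter_upwards [self_mem_nhdsWithin, mem_nhdsWithin_of_mem_nhds (ball_mem_nhds 0 hr)]
      with w hw0 hw
    have hw0 : 0 < ‖w‖ := norm_pos_iff.2 hw0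
    calc ‖w⁻¹ • (h (c + w) - h c)‖ = ‖w‖⁻¹ * ‖h (c + w) - h c‖ := by rw [norm_smul, norm_inv]
      _ ≤ ‖w‖⁻¹ * (2 * (M - (h c).re) * ‖w‖ / (r - ‖w‖)) := by gcongr; exact hgrowth w hw
      _ = 2 * (M - (h c).re) / (r - ‖w‖) := by field_simp
  have hlim : Tendsto (fun w : ℂ ↦ 2 * (M - (h c).re) / (r - ‖w‖)) (𝓝[≠] 0)
      (𝓝 (2 * (M - (h c).re) / r)) := by
    have : Tendsto (fun w : ℂ ↦ r - ‖w‖) (𝓝 0) (𝓝 r) := by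
      simpa using (tendsto_const_nhds (x := r)).sub (continuous_norm.tendsto (0 : ℂ))
    exact (tendsto_const_nhds.div this hr.ne').mono_left nhdsWithin_le_nhds
  have hderiv := (hd.differentiableAt (ball_mem_nhds c hr)).hasDerivAt
  exact le_of_tendsto_of_tendsto hderiv.tendsto_slope_zero.norm hlim hslope

theorem exists_differentiableOn_eqOn_exp {U : Set ℂ} (hUc : IsSimplyConnected U) (hUo : IsOpen U)
    {g : ℂ → ℂ} (hd : DifferentiableOn ℂ g U) (hg : ∀ z ∈ U, g z ≠ 0) :
    ∃ h : ℂ → ℂ, DifferentiableOn ℂ h U ∧ EqOn (Complex.exp ∘ h) g U := by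
  obtain ⟨h, hcont, hexp⟩ := Complex.exists_continuousOn_eqOn_exp_comp hUc hUo hd.continuousOn
    (by rintro ⟨z, hz, h0⟩; exact hg z hz h0)
  refine ⟨h, fun z hz ↦ DifferentiableAt.differentiableWithinAt ?_, hexp⟩
  have hquot : ∀ w ∈ U, g w / g z = Complex.exp (h w - h z) := fun w hw ↦ by
    rw [Complex.exp_sub, ← hexp hw, ← hexp hz, Function.comp_apply, Function.comp_apply]
  have him : ∀ᶠ w in 𝓝 z, (h w - h z).im ∈ Ioo (-Real.pi) Real.pi := by
    have hc : ContinuousAt (fun w ↦ (h w - h z).im) z :=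
      (Complex.continuous_im.continuousAt).comp
        ((hcont.continuousAt (hUo.mem_nhds hz)).sub continuousAt_const)
    exact hc.eventually_mem (by simpa using Ioo_mem_nhds (neg_lt_zero.2 Real.pi_pos) Real.pi_pos)
  -- Near `z`, a continuous logarithm is a principal branch of `log (g / g z)` up to a constant.
  have hlog : h =ᶠ[𝓝 z] fun w ↦ h z + Complex.log (g w / g z) := by
    filter_upwards [him, hUo.mem_nhds hz] with w hw hwU
    rw [hquot w hwU, Complex.log_exp hw.1 hw.2.le, add_sub_cancel]
  have hgz : DifferentiableAt ℂ (fun w ↦ g w / g z) z :=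
    (hd.differentiableAt (hUo.mem_nhds hz)).div_const _
  refine hlog.differentiableAt_iff.2 ((hgz.clog ?_).const_add _)
  rw [div_self (hg z hz)]
  exact Complex.one_mem_slitPlane

theorem isSimplyConnected_of_convex {E : Type*} [AddCommGroup E] [Module ℝ E] [TopologicalSpace E]
    [ContinuousAdd E] [ContinuousSMul ℝ E] {s : Set E} (hs : Convex ℝ s) (hne : s.Nonempty) :
    IsSimplyConnected s := by
  have := hs.contractibleSpace hne
  exact SimplyConnectedSpace.ofContractible s

theorem norm_deriv_le_of_mapsTo_ball_diff_singleton {g : ℂ → ℂ} {a c : ℂ} {r R : ℝ} (hr : 0 < r)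
    (hd : DifferentiableOn ℂ g (ball c r)) (hg : MapsTo g (ball c r) (ball a R \ {a})) :
    ‖deriv g c‖ ≤ 2 * (‖g c - a‖ * Real.log (R / ‖g c - a‖)) / r := by
  have hc : c ∈ ball c r := mem_ball_self hr
  have hne : ∀ z ∈ ball c r, g z - a ≠ 0 := fun z hz ↦ sub_ne_zero.2 (hg hz).2
  obtain ⟨h, hh, hexp⟩ :=
    exists_differentiableOn_eqOn_exp (isSimplyConnected_of_convex (convex_ball c r) ⟨c, hc⟩)
      isOpen_ball (hd.sub_const a) hne
  have hre : ∀ z ∈ ball c r, (h z).re = Real.log ‖g z - a‖ := fun z hz ↦ by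
    rw [← show Complex.exp (h z) = g z - a from hexp hz, Complex.norm_exp, Real.log_exp]
  have hschwarz := norm_deriv_le_of_re_lt (M := Real.log R) hr hh fun z hz ↦ by
    rw [hre z hz]
    exact Real.log_lt_log (norm_pos_iff.2 (hne z hz)) (mem_ball_iff_norm.1 (hg hz).1)
  have hderiv : deriv g c = (g c - a) * deriv h c := by
    have hexp' : (fun z ↦ g z - a) =ᶠ[𝓝 c] fun z ↦ Complex.exp (h z) :=
      (hexp.eventuallyEq_of_mem (ball_mem_nhds c hr)).symm
    have hhc := (hh.differentiableAt (ball_mem_nhds c hr)).hasDerivAt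
    rw [← deriv_sub_const (f := g) a, hexp'.deriv_eq, hhc.cexp.deriv]
    congr 1
    exact hexp hc
  have hpos : 0 < ‖g c - a‖ := norm_pos_iff.2 (hne c hc)
  have hR : 0 < R := hpos.trans (mem_ball_iff_norm.1 (hg hc).1)
  calc ‖deriv g c‖ = ‖g c - a‖ * ‖deriv h c‖ := by rw [hderiv, norm_mul]
    _ ≤ ‖g c - a‖ * (2 * (Real.log R - (h c).re) / r) := by gcongr
    _ = 2 * (‖g c - a‖ * Real.log (R / ‖g c - a‖)) / r := by
      rw [Real.log_div hR.ne' hpos.ne', hre c hc]; ring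

end SchwarzPunctured

section PiecewiseCurves

variable {F : Type*} [NormedAddCommGroup F] [NormedSpace ℝ F] {f : ℝ → F} {t : ℕ → ℝ}

theorem enorm_sub_le_lintegral_deriv_of_piecewise_contDiffOn (ht : Monotone t) (n : ℕ)
    (hf : ∀ i < n, ContDiffOn ℝ 1 f (Icc (t i) (t (i + 1)))) :
    ‖f (t n) - f (t 0)‖ₑ ≤ ∫⁻ x in Icc (t 0) (t n), ‖deriv f x‖ₑ := by
  induction n with
  | zero => simp
  | succ n ih =>
    have hsplit : Icc (t 0) (t (n + 1)) = Icc (t 0) (t n) ∪ Ioc (t n) (t (n + 1)) :=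
      (Icc_union_Ioc_eq_Icc (ht n.zero_le) (ht n.le_succ)).symm
    have hdisj : Disjoint (Icc (t 0) (t n)) (Ioc (t n) (t (n + 1))) :=
      disjoint_left.2 fun x hx hx' ↦ hx'.1.not_ge hx.2
    rw [hsplit, lintegral_union measurableSet_Ioc hdisj, restrict_Ioc_eq_restrict_Icc]
    calc ‖f (t (n + 1)) - f (t 0)‖ₑ
        ≤ ‖f (t n) - f (t 0)‖ₑ + ‖f (t (n + 1)) - f (t n)‖ₑ := by
          simpa only [edist_eq_enorm_sub, add_comm] using
            edist_triangle (f (t (n + 1))) (f (t n)) (f (t 0))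
      _ ≤ _ := add_le_add (ih fun i hi ↦ hf i (by omega))
          (enorm_sub_le_lintegral_deriv_of_contDiffOn_Icc (hf n n.lt_succ_self) (ht n.le_succ))

theorem ae_differentiableAt_of_piecewise_contDiffOn (ht : Monotone t) (n : ℕ)
    (hf : ∀ i < n, ContDiffOn ℝ 1 f (Icc (t i) (t (i + 1)))) :
    ∀ᵐ x ∂volume.restrict (Icc (t 0) (t n)), DifferentiableAt ℝ f x := by
  induction n with
  | zero => simp
  | succ n ih =>
    rw [← Icc_union_Ioc_eq_Icc (ht n.zero_le) (ht n.le_succ), ae_restrict_union_iff,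
      ← restrict_Ioo_eq_restrict_Ioc]
    refine ⟨ih fun i hi ↦ hf i (by omega), ?_⟩
    filter_upwards [ae_restrict_mem measurableSet_Ioo] with x hx
    exact ((hf n n.lt_succ_self).contDiffAt (Icc_mem_nhds hx.1 hx.2)).differentiableAt one_ne_zero

end PiecewiseCurves

section Kobayashi

variable {E E' : Type*} [NormedAddCommGroup E] [NormedSpace ℂ E] [NormedAddCommGroup E']
  [NormedSpace ℂ E'] {Ω : Set E} {Ω' : Set E'} {x y : E} {γ : ℝ → E}

namespace IsPiecewiseC1Curve

theorem ae_differentiableAt (hγ : IsPiecewiseC1Curve Ω x y γ) :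
    ∀ᵐ s ∂volume.restrict (Icc 0 1), DifferentiableAt ℝ γ s := by
  obtain ⟨n, t, ht, ht0, htn, hpw⟩ := hγ.piecewise
  simpa only [ht0, htn] using ae_differentiableAt_of_piecewise_contDiffOn ht n hpw

theorem contDiffOn_comp {F : Type*} [NormedAddCommGroup F] [NormedSpace ℝ F] {u : E → F}
    (hγ : IsPiecewiseC1Curve Ω x y γ) (hu : ContDiffOn ℝ 1 u Ω) :
    ∃ (n : ℕ) (t : ℕ → ℝ), Monotone t ∧ t 0 = 0 ∧ t n = 1 ∧
      ∀ i < n, ContDiffOn ℝ 1 (u ∘ γ) (Icc (t i) (t (i + 1))) := by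
  obtain ⟨n, t, ht, ht0, htn, hpw⟩ := hγ.piecewise
  refine ⟨n, t, ht, ht0, htn, fun i hi ↦ hu.comp (hpw i hi) (hγ.mapsTo.mono_left ?_)⟩
  exact Icc_subset_Icc (ht0 ▸ ht i.zero_le) (htn ▸ ht hi)

theorem comp (hγ : IsPiecewiseC1Curve Ω x y γ) {F : E → E'} (hF : ContDiffOn ℝ 1 F Ω)
    (hmaps : MapsTo F Ω Ω') : IsPiecewiseC1Curve Ω' (F x) (F y) (F ∘ γ) where
  mapsTo := hmaps.comp hγ.mapsTo
  source := congrArg F hγ.source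
  target := congrArg F hγ.target
  continuousOn := hF.continuousOn.comp hγ.continuousOn hγ.mapsTo
  piecewise := hγ.contDiffOn_comp hF

theorem reverse (hγ : IsPiecewiseC1Curve Ω x y γ) :
    IsPiecewiseC1Curve Ω y x fun s ↦ γ (1 - s) := by
  have hmaps : MapsTo (fun s : ℝ ↦ 1 - s) (Icc 0 1) (Icc 0 1) := fun s hs ↦
    ⟨sub_nonneg.2 hs.2, sub_le_self 1 hs.1⟩
  refine ⟨hγ.mapsTo.comp hmaps, by simpa using hγ.target, by simpa using hγ.source,
    hγ.continuousOn.comp (by fun_prop) hmaps, ?_⟩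
  obtain ⟨n, t, ht, ht0, htn, hpw⟩ := hγ.piecewise
  refine ⟨n, fun i ↦ 1 - t (n - i), fun i j hij ↦ ?_, by simp [htn], by simp [ht0], fun i hi ↦ ?_⟩
  · exact sub_le_sub_left (ht (Nat.sub_le_sub_left hij n)) 1
  · refine (hpw (n - (i + 1)) (by omega)).comp (by fun_prop) fun s hs ↦ ?_
    rw [show n - (i + 1) + 1 = n - i by omega]
    exact ⟨le_sub_comm.1 hs.2, sub_le_comm.1 hs.1⟩

end IsPiecewiseC1Curve

theorem kobayashiMetric_map_le (hΩ : IsOpen Ω) {F : E → E'} (hF : DifferentiableOn ℂ F Ω)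
    (hmaps : MapsTo F Ω Ω') (x ξ : E) :
    kobayashiMetric Ω' (F x) (fderiv ℂ F x ξ) ≤ kobayashiMetric Ω x ξ := by
  refine sInf_le_sInf ?_
  rintro _ ⟨r, f, hr, rfl, hf, hfΩ, rfl, rfl⟩
  have h0 : (0 : ℂ) ∈ ball (0 : ℂ) 1 := mem_ball_self one_pos
  refine ⟨r, F ∘ f, hr, rfl, hF.comp hf hfΩ, hmaps.comp hfΩ, rfl, ?_⟩
  rw [fderiv_comp_deriv 0 (hF.differentiableAt (hΩ.mem_nhds (hfΩ h0)))
    (hf.differentiableAt (isOpen_ball.mem_nhds h0)), map_smul]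

theorem kobayashiDist_le_kobayashiLength (hγ : IsPiecewiseC1Curve Ω x y γ) :
    kobayashiDist Ω x y ≤ kobayashiLength Ω γ :=
  sInf_le ⟨γ, hγ, rfl⟩

theorem kobayashiDist_map_le (hΩ : IsOpen Ω) {F : E → E'} (hF : ContDiffOn ℂ 1 F Ω)
    (hmaps : MapsTo F Ω Ω') (x y : E) :
    kobayashiDist Ω' (F x) (F y) ≤ kobayashiDist Ω x y := by
  refine le_sInf ?_
  rintro _ ⟨γ, hγ, rfl⟩
  refine (kobayashiDist_le_kobayashiLength (hγ.comp (hF.restrict_scalars ℝ) hmaps)).trans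
    (lintegral_mono_ae ?_)
  filter_upwards [hγ.ae_differentiableAt, ae_restrict_mem measurableSet_Icc] with s hγs hs
  have hFs : DifferentiableAt ℂ F (γ s) :=
    (hF.contDiffAt (hΩ.mem_nhds (hγ.mapsTo hs))).differentiableAt one_ne_zero
  have hderiv : deriv (F ∘ γ) s = fderiv ℂ F (γ s) (deriv γ s) :=
    ((hFs.hasFDerivAt.restrictScalars ℝ).comp_hasDerivAt s hγs.hasDerivAt).deriv
  rw [hderiv]
  exact kobayashiMetric_map_le hΩ (hF.differentiableOn one_ne_zero) hmaps (γ s) _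

theorem max_kobayashiDist_le_kobayashiDist_prod {U : Set E} {V : Set E'} (hU : IsOpen U)
    (hV : IsOpen V) (x y : E × E') :
    max (kobayashiDist U x.1 y.1) (kobayashiDist V x.2 y.2) ≤ kobayashiDist (U ×ˢ V) x y :=
  max_le
    (kobayashiDist_map_le (hU.prod hV) contDiff_fst.contDiffOn (fun _ h ↦ h.1) x y)
    (kobayashiDist_map_le (hU.prod hV) contDiff_snd.contDiffOn (fun _ h ↦ h.2) x y)

theorem kobayashiDist_anti {Ω Ω' : Set E} (hΩ : IsOpen Ω) (h : Ω ⊆ Ω') (x y : E) :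
    kobayashiDist Ω' x y ≤ kobayashiDist Ω x y :=
  kobayashiDist_map_le hΩ contDiffOn_id h x y

theorem kobayashiMetric_neg_le (Ω : Set E) (x ξ : E) :
    kobayashiMetric Ω x (-ξ) ≤ kobayashiMetric Ω x ξ := by
  refine sInf_le_sInf ?_
  rintro _ ⟨r, f, hr, rfl, hf, hfΩ, rfl, rfl⟩
  have hneg : MapsTo (fun ζ : ℂ ↦ -ζ) (ball 0 1) (ball 0 1) := fun ζ hζ ↦ by simpa using hζ
  exact ⟨r, fun ζ ↦ f (-ζ), hr, rfl, hf.comp (by fun_prop) hneg, hfΩ.comp hneg, by simp,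
    by simp [deriv_comp_neg]⟩

theorem kobayashiLength_reverse_le (Ω : Set E) (γ : ℝ → E) :
    kobayashiLength Ω (fun s ↦ γ (1 - s)) ≤ kobayashiLength Ω γ := by
  have hIcc : (fun s : ℝ ↦ 1 - s) ⁻¹' Icc 0 1 = Icc 0 1 := by simp
  have hflip := (volume.measurePreserving_sub_left (1 : ℝ)).restrict_preimage
    (measurableSet_Icc (a := 0) (b := 1))
  rw [hIcc] at hflip
  calc kobayashiLength Ω (fun s ↦ γ (1 - s))
      ≤ ∫⁻ s in Icc 0 1, kobayashiMetric Ω (γ (1 - s)) (deriv γ (1 - s)) :=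
        lintegral_mono fun s ↦ by
          rw [deriv_comp_const_sub]
          exact kobayashiMetric_neg_le Ω _ _
    _ = kobayashiLength Ω γ :=
        hflip.lintegral_comp_emb (MeasurableEquiv.subLeft (1 : ℝ)).measurableEmbedding
          fun s ↦ kobayashiMetric Ω (γ s) (deriv γ s)

theorem kobayashiDist_comm (Ω : Set E) (x y : E) : kobayashiDist Ω x y = kobayashiDist Ω y x := by
  have hle (x y : E) : kobayashiDist Ω y x ≤ kobayashiDist Ω x y := by
    refine le_sInf ?_
    rintro _ ⟨γ, hγ, rfl⟩
    exact (kobayashiDist_le_kobayashiLength hγ.reverse).trans (kobayashiLength_reverse_le Ω γ)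
  exact (hle y x).antisymm (hle x y)

theorem edist_le_kobayashiDist {F : Type*} [NormedAddCommGroup F] [NormedSpace ℝ F]
    (hΩ : IsOpen Ω) {u : E → F} (hu : ContDiffOn ℝ 1 u Ω)
    (hu' : ∀ x ∈ Ω, ∀ ξ, ‖fderiv ℝ u x ξ‖ₑ ≤ kobayashiMetric Ω x ξ) (x y : E) :
    edist (u x) (u y) ≤ kobayashiDist Ω x y := by
  refine le_sInf ?_
  rintro _ ⟨γ, hγ, rfl⟩
  obtain ⟨n, t, ht, ht0, htn, hpw⟩ := hγ.contDiffOn_comp hu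
  have hlength := enorm_sub_le_lintegral_deriv_of_piecewise_contDiffOn ht n hpw
  simp only [ht0, htn, Function.comp_apply, hγ.source, hγ.target] at hlength
  rw [edist_comm, edist_eq_enorm_sub]
  refine hlength.trans (lintegral_mono_ae ?_)
  filter_upwards [hγ.ae_differentiableAt, ae_restrict_mem measurableSet_Icc] with s hγs hs
  have hus : DifferentiableAt ℝ u (γ s) :=
    (hu.contDiffAt (hΩ.mem_nhds (hγ.mapsTo hs))).differentiableAt one_ne_zero
  rw [fderiv_comp_deriv s hus hγs]
  exact hu' _ (hγ.mapsTo hs) _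

end Kobayashi

section LogLog

variable {H : Type*} [NormedAddCommGroup H] {a z : H} {R : ℝ}

/-- A potential on the punctured ball `ball a R \ {a}`, tending to infinity at `a`. The factor
`1 / 2` makes its gradient at most the Kobayashi metric when the punctured ball lies in `ℂ`. -/
noncomputable def logLogPotential (R : ℝ) (a z : H) : ℝ :=
  Real.log (Real.log (R / ‖z - a‖)) / 2

theorem log_div_norm_sub_pos (hz : z ∈ ball a R \ {a}) : 0 < Real.log (R / ‖z - a‖) :=
  Real.log_pos ((one_lt_div (norm_pos_iff.2 (sub_ne_zero.2 hz.2))).2 (mem_ball_iff_norm.1 hz.1))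

variable [InnerProductSpace ℝ H]

theorem contDiffOn_logLogPotential (n : WithTop ℕ∞) :
    ContDiffOn ℝ n (logLogPotential R a) (ball a R \ {a}) := by
  have hne : ∀ z ∈ ball a R \ {a}, z - a ≠ 0 := fun z hz ↦ sub_ne_zero.2 hz.2
  have hnorm : ContDiffOn ℝ n (fun z ↦ ‖z - a‖) (ball a R \ {a}) :=
    (contDiffOn_id.sub contDiffOn_const).norm ℝ hne
  refine ((((contDiffOn_const (c := R)).div hnorm fun z hz ↦ norm_ne_zero_iff.2 (hne z hz)).log
    fun z hz h ↦ ?_).log fun z hz ↦ (log_div_norm_sub_pos hz).ne').div_const 2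
  exact (log_div_norm_sub_pos hz).ne' (by
    rw [show R / ‖z - a‖ = 0 from h, Real.log_zero])

theorem norm_fderiv_logLogPotential_le (hz : z ∈ ball a R \ {a}) :
    ‖fderiv ℝ (logLogPotential R a) z‖ ≤ (2 * (‖z - a‖ * Real.log (R / ‖z - a‖)))⁻¹ := by
  have hpos : 0 < ‖z - a‖ := norm_pos_iff.2 (sub_ne_zero.2 hz.2)
  have hlog : 0 < Real.log (R / ‖z - a‖) := log_div_norm_sub_pos hz
  have hR : 0 < R := hpos.trans (mem_ball_iff_norm.1 hz.1)
  have hnorm : DifferentiableAt ℝ (fun w ↦ ‖w - a‖) z :=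
    (differentiableAt_id.sub_const a).norm ℝ (norm_pos_iff.1 hpos)
  have hnorm' : ‖fderiv ℝ (fun w ↦ ‖w - a‖) z‖ ≤ 1 := by
    have hlip : LipschitzWith 1 fun w : H ↦ ‖w - a‖ :=
      LipschitzWith.of_dist_le_mul fun v w ↦ by
        simpa [dist_eq_norm] using abs_norm_sub_norm_le (v - a) (w - a)
    simpa using norm_fderiv_le_of_lipschitz ℝ (x₀ := z) hlip
  have hφ : HasDerivAt (fun ρ ↦ Real.log (Real.log (R / ρ)) / 2)
      (-(2 * (‖z - a‖ * Real.log (R / ‖z - a‖)))⁻¹) ‖z - a‖ := by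
    refine (((((hasDerivAt_id ‖z - a‖).inv hpos.ne').const_mul R).log
      (mul_pos hR (inv_pos.2 hpos)).ne').log hlog.ne').div_const 2 |>.congr_deriv ?_
    simp only [id_eq, Pi.inv_apply, ← div_eq_mul_inv]
    field_simp
  have hu : fderiv ℝ (logLogPotential R a) z =
      -(2 * (‖z - a‖ * Real.log (R / ‖z - a‖)))⁻¹ • fderiv ℝ (fun w ↦ ‖w - a‖) z :=
    (hφ.comp_hasFDerivAt (f := fun w ↦ ‖w - a‖) z hnorm.hasFDerivAt).fderiv
  rw [hu, norm_smul, norm_neg, Real.norm_of_nonneg (by positivity)]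
  exact mul_le_of_le_one_right (by positivity) hnorm'

end LogLog

section PlaneDomains

theorem ofReal_le_kobayashiMetric_ball_diff_singleton (a : ℂ) (R : ℝ) (z ξ : ℂ) :
    ENNReal.ofReal ((2 * (‖z - a‖ * Real.log (R / ‖z - a‖)))⁻¹ * ‖ξ‖) ≤
      kobayashiMetric (ball a R \ {a}) z ξ := by
  refine le_sInf ?_
  rintro _ ⟨r, f, hr, rfl, hf, hmaps, rfl, rfl⟩
  have h0 : f 0 ∈ ball a R \ {a} := hmaps (mem_ball_self one_pos)
  have hpos : 0 < 2 * (‖f 0 - a‖ * Real.log (R / ‖f 0 - a‖)) :=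
    mul_pos two_pos (mul_pos (norm_pos_iff.2 (sub_ne_zero.2 h0.2)) (log_div_norm_sub_pos h0))
  have hschwarz := norm_deriv_le_of_mapsTo_ball_diff_singleton one_pos hf hmaps
  rw [div_one] at hschwarz
  refine ENNReal.ofReal_le_ofReal ((inv_mul_le_iff₀ hpos).2 ?_)
  rw [norm_smul, Complex.norm_real, Real.norm_of_nonneg hr.le, mul_comm]
  gcongr

theorem edist_logLogPotential_le_kobayashiDist (a : ℂ) (R : ℝ) (z w : ℂ) :
    edist (logLogPotential R a z) (logLogPotential R a w) ≤ kobayashiDist (ball a R \ {a}) z w := by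
  refine edist_le_kobayashiDist (isOpen_ball.sdiff isClosed_singleton)
    (contDiffOn_logLogPotential 1) (fun z hz ξ ↦ ?_) z w
  calc ‖fderiv ℝ (logLogPotential R a) z ξ‖ₑ
      = ENNReal.ofReal ‖fderiv ℝ (logLogPotential R a) z ξ‖ := (ofReal_norm _).symm
    _ ≤ ENNReal.ofReal ((2 * (‖z - a‖ * Real.log (R / ‖z - a‖)))⁻¹ * ‖ξ‖) :=
      ENNReal.ofReal_le_ofReal
        (ContinuousLinearMap.le_of_opNorm_le _ (norm_fderiv_logLogPotential_le hz) ξ)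
    _ ≤ kobayashiMetric (ball a R \ {a}) z ξ :=
      ofReal_le_kobayashiMetric_ball_diff_singleton a R z ξ

theorem log_div_norm_sub_le_of_kobayashiDist_lt {U : Set ℂ} (hU : IsOpen U) {a : ℂ} {R : ℝ}
    (hUR : U ⊆ ball a R \ {a}) {z w : ℂ} (hz : z ∈ U) (hw : w ∈ U) {C : ℝ≥0}
    (hC : kobayashiDist U z w < C) :
    Real.log (R / ‖w - a‖) ≤ Real.exp (2 * C) * Real.log (R / ‖z - a‖) := by
  have hdist : dist (logLogPotential R a z) (logLogPotential R a w) < C := by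
    rw [← edist_lt_ofReal, ENNReal.ofReal_coe_nnreal]
    exact (edist_logLogPotential_le_kobayashiDist a R z w).trans_lt
      ((kobayashiDist_anti hU hUR z w).trans_lt hC)
  have hpot : Real.log (Real.log (R / ‖w - a‖)) ≤ 2 * C + Real.log (Real.log (R / ‖z - a‖)) := by
    have := (abs_lt.1 hdist).1
    unfold logLogPotential at this
    linarith
  rwa [← Real.exp_le_exp, Real.exp_add, Real.exp_log (log_div_norm_sub_pos (hUR hz)),
    Real.exp_log (log_div_norm_sub_pos (hUR hw))] at hpot

theorem isCompact_closure_inter_forall_frontier_le {X : Type*} [PseudoMetricSpace X]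
    [ProperSpace X] {U : Set X} (hU : Bornology.IsBounded U) (ε : ℝ) :
    IsCompact {w ∈ closure U | ∀ a ∈ frontier U, ε ≤ dist w a} := by
  refine hU.isCompact_closure.inter_right (t := {w | ∀ a ∈ frontier U, ε ≤ dist w a}) ?_
  simp only [ofPred_forall]
  exact isClosed_biInter fun a _ ↦
    isClosed_le continuous_const (continuous_id.dist continuous_const)

theorem exists_isCompact_forall_kobayashiDist_lt {U S : Set ℂ} (hU : IsOpen U)
    (hUb : Bornology.IsBounded U) (hS : IsCompact S) (hSU : S ⊆ U) (C : ℝ≥0) :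
    ∃ K ⊆ U, IsCompact K ∧ ∀ z ∈ S, ∀ w ∈ U, kobayashiDist U z w < C → w ∈ K := by
  obtain ⟨δ, hδ, hthick⟩ := hS.exists_thickening_subset_open hU hSU
  set R : ℝ := diam U + 1
  have hR : 0 < R := by positivity
  set ε : ℝ := R / Real.exp (Real.exp (2 * C) * Real.log (R / δ))
  have hε : 0 < ε := by positivity
  have hfrontier : ∀ a ∈ frontier U, a ∉ U := fun a ha ↦ (hU.frontier_eq ▸ ha).2
  have hUR : ∀ a ∈ frontier U, U ⊆ ball a R \ {a} := fun a ha z hz ↦ by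
    refine ⟨?_, fun h ↦ hfrontier a ha (h ▸ hz)⟩
    have := dist_le_diam_of_mem hUb.closure (subset_closure hz) (frontier_subset_closure ha)
    rw [diam_closure] at this
    exact this.trans_lt (lt_add_one _)
  refine ⟨{w ∈ closure U | ∀ a ∈ frontier U, ε ≤ dist w a}, fun w hw ↦ ?_,
    isCompact_closure_inter_forall_frontier_le hUb ε, fun z hz w hw hC ↦ ?_⟩
  · by_contra hwU
    have := hw.2 w (hU.frontier_eq ▸ ⟨hw.1, hwU⟩)
    rw [dist_self] at this
    exact hε.not_ge this
  · refine ⟨subset_closure hw, fun a ha ↦ ?_⟩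
    have hδz : δ ≤ ‖z - a‖ := by
      by_contra! h
      exact hfrontier a ha (hthick (mem_thickening_iff.2 ⟨z, hz, by rwa [dist_comm, dist_eq_norm]⟩))
    have hw0 : 0 < ‖w - a‖ := norm_pos_iff.2 (sub_ne_zero.2 (hUR a ha hw).2)
    have hlog : Real.log (R / ‖w - a‖) ≤ Real.exp (2 * C) * Real.log (R / δ) := by
      have hz0 : 0 < ‖z - a‖ := hδ.trans_le hδz
      refine (log_div_norm_sub_le_of_kobayashiDist_lt hU (hUR a ha) (hSU hz) hw hC).trans ?_
      gcongr
    rw [Real.log_le_iff_le_exp (div_pos hR hw0)] at hlog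
    rw [dist_eq_norm]
    exact (div_le_comm₀ hw0 (Real.exp_pos _)).1 hlog

theorem exists_forall_le_kobayashiDist {U S : Set ℂ} (hU : IsOpen U) (hUb : Bornology.IsBounded U)
    (hUne : U.Nonempty) (hS : IsCompact S) (hSU : S ⊆ U) (C : ℝ≥0) :
    ∃ z ∈ U, ∀ w ∈ S, C ≤ kobayashiDist U z w := by
  obtain ⟨K, hKU, hK, hfar⟩ := exists_isCompact_forall_kobayashiDist_lt hU hUb hS hSU C
  obtain ⟨z, hz, hzK⟩ : ∃ z ∈ U, z ∉ K := by
    by_contra! h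
    obtain rfl : U = K := Subset.antisymm h hKU
    exact noncompact_univ ℂ (IsClopen.eq_univ ⟨hK.isClosed, hU⟩ hUne ▸ hK)
  refine ⟨z, hz, fun w hw ↦ ?_⟩
  by_contra! hlt
  exact hzK (hfar w hw z hz (kobayashiDist_comm U z w ▸ hlt))

end PlaneDomains

section BoundedHolomorphic

variable {E F : Type*} [NormedAddCommGroup E] [NormedSpace ℂ E] [NormedAddCommGroup F]
  [NormedSpace ℂ F]

theorem tendstoLocallyUniformlyOn_of_norm_le {ι : Type*} {l : Filter ι} {f : ι → E → F} {g : E → F}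
    {U : Set E} {M : ℝ} (hU : IsOpen U) (hf : ∀ i, DifferentiableOn ℂ (f i) U)
    (hM : ∀ i, ∀ z ∈ U, ‖f i z‖ ≤ M) (hlim : ∀ z ∈ U, Tendsto (f · z) l (𝓝 (g z))) :
    TendstoLocallyUniformlyOn f g l U := by
  rw [Metric.tendstoLocallyUniformlyOn_iff]
  intro ε hε x hx
  rcases l.eq_or_neBot with rfl | hl
  · exact ⟨univ, univ_mem, by simp⟩
  obtain ⟨δ, hδ, hball⟩ := Metric.isOpen_iff.1 hU x hx
  have hlip : ∀ i, ∀ y ∈ ball x δ, dist (f i y) (f i x) ≤ (M + M) / δ * dist y x := fun i y hy ↦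
    Complex.dist_le_div_mul_dist_of_mapsTo_ball ((hf i).mono hball)
      (fun z hz ↦ by
        simpa [dist_eq_norm] using norm_sub_le_of_le (hM i z (hball hz)) (hM i x hx)) hy
  have hlip' : ∀ y ∈ ball x δ, dist (g y) (g x) ≤ (M + M) / δ * dist y x := fun y hy ↦
    le_of_tendsto ((hlim y (hball hy)).dist (hlim x hx)) (.of_forall fun i ↦ hlip i y hy)
  have hsmall : ∀ᶠ y in 𝓝 x, (M + M) / δ * dist y x < ε / 3 := by
    have : Tendsto (fun y ↦ (M + M) / δ * dist y x) (𝓝 x) (𝓝 0) := by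
      simpa using ((continuous_id.dist (continuous_const (y := x))).const_mul _).tendsto x
    exact this.eventually_lt_const (by positivity)
  refine ⟨_, mem_nhdsWithin_of_mem_nhds (hsmall.and (ball_mem_nhds x hδ)), ?_⟩
  filter_upwards [Metric.tendsto_nhds.1 (hlim x hx) (ε / 3) (by positivity)] with i hi y hy
  calc dist (g y) (f i y) ≤ dist (g y) (g x) + dist (g x) (f i x) + dist (f i x) (f i y) :=
        dist_triangle4 _ _ _ _
    _ < ε / 3 + ε / 3 + ε / 3 := by
        refine add_lt_add (add_lt_add ((hlip' y hy.2).trans_lt hy.1) (dist_comm _ (g x) ▸ hi)) ?_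
        rw [dist_comm]
        exact (hlip i y hy.2).trans_lt hy.1
    _ = ε := by ring

end BoundedHolomorphic

section Basins

section Topological

variable {X Y : Type*} [TopologicalSpace X] [TopologicalSpace Y]

theorem connectedComponentIn_prod {A : Set X} {B : Set Y} {x : X × Y} (hx : x ∈ A ×ˢ B) :
    connectedComponentIn (A ×ˢ B) x =
      connectedComponentIn A x.1 ×ˢ connectedComponentIn B x.2 := by
  refine Subset.antisymm (fun y hy ↦ ⟨?_, ?_⟩) ?_
  · exact connectedComponentIn_mono _ (fst_image_prod_subset A B)
      (continuous_fst.continuousOn.mapsTo_connectedComponentIn hx hy)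
  · exact connectedComponentIn_mono _ (snd_image_prod_subset A B)
      (continuous_snd.continuousOn.mapsTo_connectedComponentIn hx hy)
  · exact (isPreconnected_connectedComponentIn.prod
      isPreconnected_connectedComponentIn).subset_connectedComponentIn
      ⟨mem_connectedComponentIn hx.1, mem_connectedComponentIn hx.2⟩
      (prod_mono (connectedComponentIn_subset _ _) (connectedComponentIn_subset _ _))

theorem attractionBasin_prodMap (f : X → X) (g : Y → Y) (p : X × Y) :
    attractionBasin (Prod.map f g) p = attractionBasin f p.1 ×ˢ attractionBasin g p.2 := by
  ext x
  simp only [attractionBasin, Prod.map_iterate, mem_ofPred_eq, mem_prod, Prod.tendsto_iff,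
    Prod.map_fst, Prod.map_snd]

theorem mapsTo_attractionBasin (f : X → X) (p : X) :
    MapsTo f (attractionBasin f p) (attractionBasin f p) := fun _ hx ↦
  (tendsto_add_atTop_iff_nat 1).2 hx

end Topological

/-- The points whose forward orbit under `f` passes through `p`, i.e. `⋃ k, f⁻ᵏ(p)`. -/
def backwardOrbit {X : Type*} (f : X → X) (p : X) : Set X :=
  {x | ∃ k : ℕ, f^[k] x = p}

theorem backwardOrbit_subset_singleton {X : Type*} {f : X → X} {p : X} (hf : ∀ x, f x = p → x = p) :
    backwardOrbit f p ⊆ {p} := by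
  rintro x ⟨k, hk⟩
  induction k with
  | zero => exact hk
  | succ k ih => exact ih (hf _ (Function.iterate_succ_apply' f k x ▸ hk))

theorem isBounded_attractionBasin {E : Type*} [SeminormedAddCommGroup E] {f : E → E}
    (hf : ∀ᶠ x in Bornology.cobounded E, ‖x‖ ≤ ‖f x‖) (a : E) :
    Bornology.IsBounded (attractionBasin f a) := by
  obtain ⟨R, -, hR⟩ := (hasBasis_cobounded_compl_closedBall (0 : E)).eventually_iff.1 hf
  simp only [mem_compl_iff, mem_closedBall_zero_iff, not_le] at hR
  refine (isBounded_closedBall (x := (0 : E)) (r := max R ‖a‖)).subset fun x hx ↦ ?_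
  by_contra! hxR
  rw [mem_closedBall_zero_iff, not_le, max_lt_iff] at hxR
  have hgrow : ∀ n, ‖x‖ ≤ ‖f^[n] x‖ := fun n ↦ by
    induction n with
    | zero => exact le_rfl
    | succ n ih =>
      rw [Function.iterate_succ_apply']
      exact ih.trans (hR (hxR.1.trans_le ih))
  exact hxR.2.not_ge (ge_of_tendsto' (Tendsto.norm hx) hgrow)

theorem tendstoLocallyUniformlyOn_iterate {E : Type*} [NormedAddCommGroup E] [NormedSpace ℂ E]
    {f : E → E} (hf : Differentiable ℂ f) {a : E}
    (hb : Bornology.IsBounded (attractionBasin f a)) :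
    TendstoLocallyUniformlyOn (fun n ↦ f^[n]) (fun _ ↦ a) atTop
      (interior (attractionBasin f a)) := by
  obtain ⟨M, hM⟩ := hb.exists_norm_le
  exact tendstoLocallyUniformlyOn_of_norm_le isOpen_interior
    (fun n ↦ (hf.iterate n).differentiableOn)
    (fun n z hz ↦ hM _ ((mapsTo_attractionBasin f a).iterate n (interior_subset hz)))
    fun z hz ↦ interior_subset hz

theorem norm_deriv_lt_one_of_mem_interior_attractionBasin {f : ℂ → ℂ} (hf : Differentiable ℂ f)
    {a : ℂ} (ha : f a = a) (hb : Bornology.IsBounded (attractionBasin f a))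
    (hmem : a ∈ interior (attractionBasin f a)) : ‖deriv f a‖ < 1 := by
  have hderiv : Tendsto (fun n ↦ deriv f^[n] a) atTop (𝓝 (deriv (fun _ ↦ a) a)) :=
    ((tendstoLocallyUniformlyOn_iterate hf hb).deriv
      (.of_forall fun n ↦ (hf.iterate n).differentiableOn) isOpen_interior).tendsto_at hmem
  have hpow (n : ℕ) : deriv f^[n] a = deriv f a ^ n := (hf a).hasDerivAt.iterate a ha n |>.deriv
  simp only [hpow, deriv_const] at hderiv
  exact tendsto_pow_atTop_nhds_zero_iff_norm_lt_one.1 hderiv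

theorem backwardOrbit_inter_interior_attractionBasin_eq_empty {f : ℂ → ℂ}
    (hf : Differentiable ℂ f) (hopen : IsOpenMap f) {a : ℂ} (ha : f a = a)
    (hb : Bornology.IsBounded (attractionBasin f a)) (hderiv : 1 ≤ ‖deriv f a‖) :
    backwardOrbit f a ∩ interior (attractionBasin f a) = ∅ := by
  rw [← disjoint_iff_inter_eq_empty, disjoint_left]
  rintro x ⟨k, hk⟩ hx
  have hmem : f^[k] x ∈ interior (attractionBasin f a) :=
    (hopen.mapsTo_interior (mapsTo_attractionBasin f a)).iterate k hx
  rw [hk] at hmem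
  exact hderiv.not_gt (norm_deriv_lt_one_of_mem_interior_attractionBasin hf ha hb hmem)

end Basins

section FarFromPreimages

variable {U V : Set ℂ}

theorem exists_far_of_tendstoLocallyUniformlyOn (hU : IsOpen U) (hUb : Bornology.IsBounded U)
    (hUne : U.Nonempty) (hV : IsOpen V) (hVb : Bornology.IsBounded V) (hVne : V.Nonempty)
    {f g : ℕ → ℂ → ℂ} {a p q : ℂ} (hf : TendstoLocallyUniformlyOn f (fun _ ↦ a) atTop U)
    (hpa : p ≠ a) (hg : ∀ k, (g k ⁻¹' {q}).Finite) (C : ℝ≥0) :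
    ∃ z ∈ U, ∃ w ∈ V, ∀ k, ∀ z' ∈ U, ∀ w' ∈ V, f k z' = p → g k w' = q →
      C ≤ max (kobayashiDist U z z') (kobayashiDist V w w') := by
  obtain ⟨z, hz⟩ := hUne
  obtain ⟨K, hKU, hK, hfar⟩ := exists_isCompact_forall_kobayashiDist_lt hU hUb
    isCompact_singleton (singleton_subset_iff.2 hz) C
  have hlate : ∀ᶠ k in atTop, ∀ z' ∈ K, f k z' ≠ p := by
    have hunif := (tendstoLocallyUniformlyOn_iff_forall_isCompact hU).1 hf K hKU hK
    filter_upwards [Metric.tendstoUniformlyOn_iff.1 hunif (dist a p) (dist_pos.2 hpa.symm)]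
      with k hk z' hz' h
    exact (hk z' hz').ne (h ▸ rfl)
  obtain ⟨N, hN⟩ := eventually_atTop.1 hlate
  have hearly : (V ∩ ⋃ k ∈ Iio N, g k ⁻¹' {q}).Finite :=
    ((finite_Iio N).biUnion fun k _ ↦ hg k).inter_of_right V
  obtain ⟨w, hw, hwfar⟩ :=
    exists_forall_le_kobayashiDist hV hVb hVne hearly.isCompact inter_subset_left C
  refine ⟨z, hz, w, hw, fun k z' hz' w' hw' hfk hgk ↦ ?_⟩
  rcases lt_or_ge k N with hk | hk
  · exact le_max_of_le_right (hwfar w' ⟨hw', mem_biUnion hk hgk⟩)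
  · refine le_max_of_le_left ?_
    by_contra! hlt
    exact hN k hk z' (hfar z rfl z' hz' hlt) hfk

theorem exists_far_of_ne_or_finite_backwardOrbit (hU : IsOpen U) (hUb : Bornology.IsBounded U)
    (hUne : U.Nonempty) (hV : IsOpen V) (hVb : Bornology.IsBounded V) (hVne : V.Nonempty)
    {f g : ℂ → ℂ} {a p q : ℂ} (hf : TendstoLocallyUniformlyOn (fun k ↦ f^[k]) (fun _ ↦ a) atTop U)
    (hg : ∀ k, (g^[k] ⁻¹' {q}).Finite) (hp : p ≠ a ∨ (backwardOrbit f p ∩ U).Finite) (C : ℝ≥0) :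
    ∃ z ∈ U, ∃ w ∈ V, ∀ k, ∀ z' ∈ U, ∀ w' ∈ V, f^[k] z' = p → g^[k] w' = q →
      C ≤ max (kobayashiDist U z z') (kobayashiDist V w w') := by
  rcases hp with hpa | hfin
  · exact exists_far_of_tendstoLocallyUniformlyOn hU hUb hUne hV hVb hVne hf hpa hg C
  · obtain ⟨z, hz, hfar⟩ :=
      exists_forall_le_kobayashiDist hU hUb hUne hfin.isCompact inter_subset_right C
    obtain ⟨w, hw⟩ := hVne
    exact ⟨z, hz, w, hw, fun k z' hz' w' _ hk _ ↦ le_max_of_le_left (hfar z' ⟨⟨k, hk⟩, hz'⟩)⟩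

theorem exists_forall_le_kobayashiDist_prod (hU : IsOpen U) (hUb : Bornology.IsBounded U)
    (hUne : U.Nonempty) (hV : IsOpen V) (hVb : Bornology.IsBounded V) (hVne : V.Nonempty)
    {f g : ℂ → ℂ} {a : ℂ × ℂ} (hf : TendstoLocallyUniformlyOn (fun k ↦ f^[k]) (fun _ ↦ a.1) atTop U)
    (hg : TendstoLocallyUniformlyOn (fun k ↦ g^[k]) (fun _ ↦ a.2) atTop V)
    (hf' : ∀ k z, (f^[k] ⁻¹' {z}).Finite) (hg' : ∀ k w, (g^[k] ⁻¹' {w}).Finite)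
    (hfin : (backwardOrbit f a.1 ∩ U).Finite ∨ (backwardOrbit g a.2 ∩ V).Finite)
    (p : ℂ × ℂ) (C : ℝ≥0) :
    ∃ x₀ ∈ U ×ˢ V, ∀ k, ∀ x ∈ U ×ˢ V, (Prod.map f g)^[k] x = p →
      C ≤ kobayashiDist (U ×ˢ V) x₀ x := by
  have hcases : (p.1 ≠ a.1 ∨ (backwardOrbit f p.1 ∩ U).Finite) ∨
      (p.2 ≠ a.2 ∨ (backwardOrbit g p.2 ∩ V).Finite) := by
    by_cases h₁ : p.1 = a.1
    · by_cases h₂ : p.2 = a.2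
      · simpa only [h₁, h₂, ne_eq, not_true, false_or] using hfin
      · exact .inr (.inl h₂)
    · exact .inl (.inl h₁)
  obtain ⟨z, hz, w, hw, hfar⟩ : ∃ z ∈ U, ∃ w ∈ V, ∀ k, ∀ z' ∈ U, ∀ w' ∈ V,
      f^[k] z' = p.1 → g^[k] w' = p.2 → C ≤ max (kobayashiDist U z z') (kobayashiDist V w w') := by
    rcases hcases with hp | hp
    · exact exists_far_of_ne_or_finite_backwardOrbit hU hUb hUne hV hVb hVne hf (hg' · _) hp C
    · obtain ⟨w, hw, z, hz, hfar⟩ :=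
        exists_far_of_ne_or_finite_backwardOrbit hV hVb hVne hU hUb hUne hg (hf' · _) hp C
      exact ⟨z, hz, w, hw, fun k z' hz' w' hw' hz'k hw'k ↦
        max_comm (kobayashiDist U z z') _ ▸ hfar k w' hw' z' hz' hw'k hz'k⟩
  refine ⟨(z, w), ⟨hz, hw⟩, fun k x hx hk ↦ ?_⟩
  rw [Prod.map_iterate, Prod.ext_iff] at hk
  exact (hfar k x.1 hx.1 x.2 hx.2 hk.1 hk.2).trans
    (max_kobayashiDist_le_kobayashiDist_prod hU hV (z, w) x)

end FarFromPreimages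

section Polynomial

open Polynomial

theorem finite_preimage_eval_singleton {R : Type*} [CommRing R] [IsDomain R] {P : R[X]}
    (hP : P.natDegree ≠ 0) (a : R) : ((P.eval ·) ⁻¹' {a}).Finite := by
  classical
  have hPa : P ≠ C a := fun h ↦ hP (h ▸ natDegree_C a)
  exact preimage_eval_singleton hPa ▸ rootSet_finite _ _

theorem finite_preimage_iterate_eval_singleton {R : Type*} [CommRing R] [IsDomain R] {P : R[X]}
    (hP : P.natDegree ≠ 0) (k : ℕ) (a : R) : ((P.eval ·)^[k] ⁻¹' {a}).Finite := by
  have hcomp : (P.eval ·)^[k] = ((P.comp^[k] X).eval ·) := by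
    ext z
    rw [iterate_comp_eval, eval_X]
  rw [hcomp]
  refine finite_preimage_eval_singleton ?_ a
  rw [natDegree_iterate_comp, natDegree_X, mul_one]
  exact pow_ne_zero k hP

theorem isOpenMap_polynomial_eval {P : ℂ[X]} (hP : P.natDegree ≠ 0) : IsOpenMap (P.eval ·) := by
  refine (AnalyticOnNhd.eval_polynomial P).is_constant_or_isOpenMap.resolve_left ?_
  rintro ⟨a, ha⟩
  exact infinite_univ ((finite_preimage_eval_singleton hP a).subset fun z _ ↦ ha z)

theorem isBounded_attractionBasin_eval {𝕜 : Type*} [NormedField 𝕜] {P : 𝕜[X]}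
    (hP : 2 ≤ P.natDegree) (a : 𝕜) : Bornology.IsBounded (attractionBasin (P.eval ·) a) := by
  have hdeg : (X : 𝕜[X]).degree < P.degree :=
    degree_lt_degree (natDegree_X_le.trans_lt hP)
  refine isBounded_attractionBasin ?_ a
  simpa only [eval_X, one_mul] using (isLittleO_cobounded_of_degree_lt hdeg).bound one_pos

theorem finite_backwardOrbit_X_pow_zero {R : Type*} [Semiring R] [NoZeroDivisors R] (m : ℕ) :
    (backwardOrbit ((X ^ m : R[X]).eval ·) 0).Finite :=
  (finite_singleton 0).subset (backwardOrbit_subset_singleton fun z hz ↦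
    eq_zero_of_pow_eq_zero (n := m) (by simpa only [eval_X_pow] using hz))

theorem backwardOrbit_eval_inter_interior_attractionBasin_eq_empty {P : ℂ[X]}
    (hP : 2 ≤ P.natDegree) {a : ℂ} (ha : P.eval a = a) (hderiv : 1 ≤ ‖P.derivative.eval a‖) :
    backwardOrbit (P.eval ·) a ∩ interior (attractionBasin (P.eval ·) a) = ∅ :=
  backwardOrbit_inter_interior_attractionBasin_eq_empty P.differentiable
    (isOpenMap_polynomial_eval (by omega)) ha (isBounded_attractionBasin_eval hP a)
    (by rwa [P.deriv])

theorem theorem3p3_general {P Q : ℂ[X]} (hPdeg : 2 ≤ P.natDegree) (hQdeg : 2 ≤ Q.natDegree)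
    {q : ℂ × ℂ}
    (hfin : (backwardOrbit (P.eval ·) q.1 ∩ interior (attractionBasin (P.eval ·) q.1)).Finite ∨
      (backwardOrbit (Q.eval ·) q.2 ∩ interior (attractionBasin (Q.eval ·) q.2)).Finite)
    {Ω : Set (ℂ × ℂ)} (hΩ : ∃ c ∈ interior (attractionBasin (productMap P Q) q),
      Ω = connectedComponentIn (interior (attractionBasin (productMap P Q) q)) c)
    (p : ℂ × ℂ) (C : ℝ) :
    ∃ x₀ ∈ Ω, ∀ (k : ℕ) (x : ℂ × ℂ), x ∈ Ω → (productMap P Q)^[k] x = p →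
      ENNReal.ofReal C ≤ kobayashiDist Ω x₀ x := by
  obtain ⟨c, hc, rfl⟩ := hΩ
  have hmap : productMap P Q = Prod.map (P.eval ·) (Q.eval ·) := rfl
  simp only [hmap, attractionBasin_prodMap, interior_prod_eq] at hc ⊢
  rw [connectedComponentIn_prod hc]
  have hP := isBounded_attractionBasin_eval hPdeg q.1
  have hQ := isBounded_attractionBasin_eval hQdeg q.2
  have hA := connectedComponentIn_subset (interior (attractionBasin (P.eval ·) q.1)) c.1
  have hB := connectedComponentIn_subset (interior (attractionBasin (Q.eval ·) q.2)) c.2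
  obtain ⟨x₀, hx₀, hfar⟩ := exists_forall_le_kobayashiDist_prod
    isOpen_interior.connectedComponentIn (hP.subset (hA.trans interior_subset))
    ⟨c.1, mem_connectedComponentIn hc.1⟩
    isOpen_interior.connectedComponentIn (hQ.subset (hB.trans interior_subset))
    ⟨c.2, mem_connectedComponentIn hc.2⟩
    ((tendstoLocallyUniformlyOn_iterate P.differentiable hP).mono hA)
    ((tendstoLocallyUniformlyOn_iterate Q.differentiable hQ).mono hB)
    (finite_preimage_iterate_eval_singleton (by omega))
    (finite_preimage_iterate_eval_singleton (by omega))
    (hfin.imp (.subset · (inter_subset_inter_right _ hA))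
      (.subset · (inter_subset_inter_right _ hB))) p C.toNNReal
  exact ⟨x₀, hx₀, hfar⟩

end Polynomial

end

theorem theorem3p3 (P Q : Polynomial ℂ) (hPdeg : 2 ≤ P.natDegree) (hQdeg : 2 ≤ Q.natDegree)
    (hP0 : P.eval 0 = 0) (hQ0 : Q.eval 0 = 0)
    (hcases :
      ((∃ m : ℕ, P = Polynomial.X ^ m) ∧
        0 < ‖Q.derivative.eval 0‖ ∧ ‖Q.derivative.eval 0‖ < 1) ∨
      ((∃ m : ℕ, P = Polynomial.X ^ m) ∧ Q.derivative.eval 0 = 1) ∨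
      ((0 < ‖P.derivative.eval 0‖ ∧ ‖P.derivative.eval 0‖ < 1) ∧ Q.derivative.eval 0 = 1) ∨
      (P.derivative.eval 0 = 1 ∧ Q.derivative.eval 0 = 1))
    (Ω : Set (ℂ × ℂ)) (hΩ : IsImmediateBasin (productMap P Q) (0, 0) Ω) :
    ∃ r : ℝ, 0 < r ∧ ∀ p : ℂ × ℂ, ‖p‖ < r → ∀ C : ℝ, 0 < C →
      ∃ x₀ ∈ Ω, ∀ (k : ℕ) (x : ℂ × ℂ), x ∈ Ω → (productMap P Q)^[k] x = p →
        ENNReal.ofReal C ≤ kobayashiDist Ω x₀ x := by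
  have hPQ : (∃ m : ℕ, P = Polynomial.X ^ m) ∨ Q.derivative.eval 0 = 1 := by tauto
  exact ⟨1, one_pos, fun p _ C _ ↦ theorem3p3_general hPdeg hQdeg
    (hPQ.imp (fun ⟨m, hm⟩ ↦ hm ▸ (finite_backwardOrbit_X_pow_zero m).inter_of_left _) fun hQ1 ↦
      backwardOrbit_eval_inter_interior_attractionBasin_eq_empty hQdeg hQ0 (hQ1 ▸ norm_one.ge) ▸
        finite_empty) hΩ.1 p C⟩
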